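/- Let $(\Omega,\Sigma,\mu)$ be a probability space and let $(f_n)_{n\ge 1}$ be a sequence of non-negative (real-valued) random variables on it. Assume that $$b:=\lim_{k\to\infty}\ \sup_{n}\ \mu(\{f_n\ge k\})>0 .$$ Then there exist a measurable set $C\in\Sigma$ with $\mu(C)>0$ and a subsequence $(g_n)_n$ of $(f_n)_n$ such that: (1) for every strictly increasing sequence $\psi$ of positive integers and every permutation $\pi$ of $\{1,2,\dots\}$, $$\lim_{m\to\infty}\ \frac1m\sum_{k=1}^{m} g_{\psi(\pi(k))}(\omega)=+\infty\qquad\text{for $\mu$-almost every }\omega\in C,$$ where the exceptional null set may depend on $\psi$ and $\pi$; (2) $$\lim_{k\to\infty}\ \sup_{n}\ \mu\big(\{g_n\mathbf 1_{C^c}\ge k\}\big)=0 .$$ -/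

import Mathlib

open MeasureTheory Filter Topology
open scoped ENNReal

/-- The Cesàro mean `S_m(h) = (1/m) ∑ h_k` of the first `m` terms of a sequence of real functions
(sequences are indexed by `ℕ`, so the first `m` terms are `h 0, …, h (m - 1)`). -/
noncomputable def cesaroMean {Ω : Type*} (h : ℕ → Ω → ℝ) (m : ℕ) (ω : Ω) : ℝ :=
  (1 / (m : ℝ)) * ∑ k ∈ Finset.range m, h k ω

/-- The quantity `sup_n μ(h_n ≥ k)`. -/
noncomputable def supTail {Ω : Type*} [MeasurableSpace Ω] (μ : Measure Ω) (h : ℕ → Ω → ℝ)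
    (k : ℕ) : ℝ≥0∞ :=
  ⨆ n : ℕ, μ {ω | (k : ℝ) ≤ h n ω}

/-! In `L²`, let `p k` be the weak limit in `n`, along an ultrafilter, of the indicators of `{f n ≥
k}`, and `q` a weak limit of the `p k`; then `q ≤ p k`. The ultrafilter keeps the tails above some
`c > 0`, so `∫ q ≥ c` and `C = {q > 0}` has positive measure. A subsequence makes the centred
indicators almost orthogonal at each level. The resulting variance bound holds for sums over any
finite index set, so it survives rearrangement, and averages along squares converge a.e. to `p k ≥
q`. Hence on `C` the value `k` is exceeded with lower frequency at least `q / 8` for every `k`, and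
the means diverge. Off `C`, `∫ q ≤ 0`, so the limiting tails vanish; the same extraction makes them
uniform in `n`. -/

theorem exists_weak_limit_ultrafilter {H ι : Type*} [NormedAddCommGroup H]
    [InnerProductSpace ℝ H] [CompleteSpace H] (U : Ultrafilter ι) (x : ι → H) {M : ℝ}
    (hx : ∀ i, ‖x i‖ ≤ M) :
    ∃ z : H, ‖z‖ ≤ M ∧ ∀ y, Tendsto (fun i => inner ℝ (x i) y) U (𝓝 (inner ℝ z y)) := by
  let φ : ι → WeakDual ℝ H := fun i =>
    StrongDual.toWeakDual (InnerProductSpace.toDual ℝ H (x i))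
  have hK := WeakDual.isCompact_closedBall (𝕜 := ℝ) (E := H) 0 M
  obtain ⟨l, hlM, hl⟩ := hK.ultrafilter_le_nhds (U.map φ) (by
    rw [le_principal_iff, Ultrafilter.mem_coe, Ultrafilter.mem_map]
    refine Filter.univ_mem' fun i => ?_
    simpa [φ] using hx i)
  refine ⟨(InnerProductSpace.toDual ℝ H).symm (WeakDual.toStrongDual l),
    by simpa using hlM, fun y => ?_⟩
  have h1 : Tendsto φ U (𝓝 l) := hl
  have h2 := ((WeakDual.eval_continuous (𝕜 := ℝ) (E := H) y).tendsto l).comp h1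
  simpa [φ, Function.comp_def] using h2

/-- Adding a new largest index creates cross terms only with smaller indices, which `D` controls. -/
theorem norm_sum_sq_le_of_almost_orthogonal {H : Type*} [NormedAddCommGroup H]
    [InnerProductSpace ℝ H] (v : ℕ → H) {M D : ℝ} (hM : ∀ j, ‖v j‖ ≤ M)
    (hD : ∀ j, ∑ i ∈ Finset.range j, |inner ℝ (v i) (v j)| ≤ D) (F : Finset ℕ) :
    ‖∑ i ∈ F, v i‖ ^ 2 ≤ F.card * (M ^ 2 + 2 * D) := by
  induction F using Finset.induction_on_max with
  | empty => simp
  | insert a s hs ih =>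
    have ha : a ∉ s := fun h => lt_irrefl a (hs a h)
    rw [Finset.sum_insert ha, Finset.card_insert_of_notMem ha, add_comm (v a),
      norm_add_sq_real, sum_inner]
    have h1 : ∑ i ∈ s, inner ℝ (v i) (v a) ≤ D :=
      (Finset.sum_le_sum fun i _ => le_abs_self _).trans
        ((Finset.sum_le_sum_of_subset_of_nonneg (fun i hi => Finset.mem_range.2 (hs i hi))
          fun i _ _ => abs_nonneg _).trans (hD a))
    have h2 : ‖v a‖ ^ 2 ≤ M ^ 2 := pow_le_pow_left₀ (norm_nonneg _) (hM a) 2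
    push_cast
    linarith

theorem ae_tendsto_zero_of_summable_norm_sq {Ω : Type*} [MeasurableSpace Ω] {μ : Measure Ω}
    (F : ℕ → Lp ℝ 2 μ) (hF : Summable fun j => ‖F j‖ ^ 2) :
    ∀ᵐ ω ∂μ, Tendsto (fun j => F j ω) atTop (𝓝 0) := by
  have hmeas : ∀ j, AEMeasurable (fun ω => ‖F j ω‖ₑ ^ 2) μ := fun j =>
    (Lp.aestronglyMeasurable (F j)).enorm.pow_const 2
  have hnorm : ∀ j, ∫⁻ ω, ‖F j ω‖ₑ ^ 2 ∂μ = ENNReal.ofReal (‖F j‖ ^ 2) := fun j => by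
    have h := eLpNorm_nnreal_pow_eq_lintegral (μ := μ) (f := F j) (p := 2) (by norm_num)
    rw [ENNReal.ofReal_pow (norm_nonneg _), Lp.norm_def,
      ENNReal.ofReal_toReal (Lp.eLpNorm_ne_top _)]
    simpa using h.symm
  have hfin : ∫⁻ ω, ∑' j, ‖F j ω‖ₑ ^ 2 ∂μ ≠ ⊤ := by
    rw [lintegral_tsum hmeas]
    simp_rw [hnorm]
    exact hF.tsum_ofReal_ne_top
  filter_upwards [ae_lt_top' (AEMeasurable.tsum hmeas) hfin] with ω hω
  have h := ENNReal.tendsto_atTop_zero_of_tsum_ne_top hω.ne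
  rw [tendsto_zero_iff_enorm_tendsto_zero]
  have h2 := ((ENNReal.continuous_rpow_const (y := (1 / 2 : ℝ))).tendsto 0).comp h
  rw [ENNReal.zero_rpow_of_pos (by norm_num)] at h2
  refine h2.congr fun j => ?_
  rw [Function.comp_apply, ← ENNReal.rpow_natCast, ← ENNReal.rpow_mul]
  norm_num

/-! ### Uniform tails -/

theorem setOf_natCast_le_antitone {Ω : Type*} (h : Ω → ℝ) :
    Antitone fun k : ℕ => {ω | (k : ℝ) ≤ h ω} := by
  intro i j hij ω (hω : (j : ℝ) ≤ h ω)
  exact le_trans (Nat.cast_le.2 hij) hω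

theorem tendsto_measure_nat_le_zero {Ω : Type*} [MeasurableSpace Ω] (μ : Measure Ω)
    [IsFiniteMeasure μ] {h : Ω → ℝ} (hh : Measurable h) :
    Tendsto (fun k : ℕ => μ {ω | (k : ℝ) ≤ h ω}) atTop (𝓝 0) := by
  have h1 := tendsto_measure_iInter_atTop (μ := μ) (s := fun k : ℕ => {ω | (k : ℝ) ≤ h ω})
    (fun k => (measurableSet_le measurable_const hh).nullMeasurableSet)
    (setOf_natCast_le_antitone h) ⟨0, measure_ne_top _ _⟩
  have h2 : ⋂ k : ℕ, {ω | (k : ℝ) ≤ h ω} = ∅ := by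
    ext ω
    obtain ⟨k, hk⟩ := exists_nat_gt (h ω)
    simpa using ⟨k, hk⟩
  rwa [h2, measure_empty] at h1

theorem supTail_antitone {Ω : Type*} [MeasurableSpace Ω] (μ : Measure Ω) (h : ℕ → Ω → ℝ) :
    Antitone (supTail μ h) := fun _ _ hij =>
  iSup_mono fun _ => measure_mono (setOf_natCast_le_antitone _ hij)

theorem tendsto_supTail_zero {Ω : Type*} [MeasurableSpace Ω] (μ : Measure Ω)
    [IsFiniteMeasure μ] {h : ℕ → Ω → ℝ} (hh : ∀ n, Measurable (h n))
    (H : ∀ ε : ℝ≥0∞, 0 < ε → ∃ k N : ℕ, ∀ n ≥ N, μ {ω | (k : ℝ) ≤ h n ω} ≤ ε) :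
    Tendsto (supTail μ h) atTop (𝓝 0) := by
  rw [ENNReal.tendsto_atTop_zero]
  intro ε hε
  obtain ⟨k, N, hkN⟩ := H ε hε
  have h1 : ∀ᶠ j : ℕ in atTop, ∀ n ∈ Finset.range N, μ {ω | (j : ℝ) ≤ h n ω} < ε :=
    (Finset.eventually_all _).2 fun n _ =>
      (tendsto_measure_nat_le_zero μ (hh n)).eventually_lt_const hε
  obtain ⟨j, hj, hjk⟩ := (h1.and (eventually_ge_atTop k)).exists
  refine ⟨j, fun i hi => (supTail_antitone μ h hi).trans (iSup_le fun n => ?_)⟩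
  rcases lt_or_ge n N with hn | hn
  · exact (hj n (Finset.mem_range.2 hn)).le
  · exact (measure_mono (setOf_natCast_le_antitone _ hjk)).trans (hkN n hn)

/-- The first `k` functions have tails below `c` at a high enough level, so the witness at that
level has a larger index. -/
theorem exists_ge_lt_measure_of_lt_supTail {Ω : Type*} [MeasurableSpace Ω] (μ : Measure Ω)
    [IsFiniteMeasure μ] {h : ℕ → Ω → ℝ} (hh : ∀ n, Measurable (h n)) {c : ℝ≥0∞} (hc : 0 < c)
    (H : ∀ k, c < supTail μ h k) (k : ℕ) : ∃ n ≥ k, c < μ {ω | (k : ℝ) ≤ h n ω} := by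
  have h1 : ∀ᶠ j : ℕ in atTop, ∀ n ∈ Finset.range k, μ {ω | (j : ℝ) ≤ h n ω} < c :=
    (Finset.eventually_all _).2 fun n _ =>
      (tendsto_measure_nat_le_zero μ (hh n)).eventually_lt_const hc
  obtain ⟨j, hj, hjk⟩ := (h1.and (eventually_ge_atTop k)).exists
  obtain ⟨n, hn⟩ := lt_iSup_iff.1 (H j)
  refine ⟨n, not_lt.1 fun hlt => ?_, hn.trans_le
    (measure_mono (setOf_natCast_le_antitone _ hjk))⟩
  exact (hj n (Finset.mem_range.2 hlt)).not_gt hn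

/-! ### Averages along squares -/

/-- Lower bounds for the averages of a nonnegative sequence along the squares propagate to all
averages, up to a constant factor. -/
theorem eventually_mul_le_sum_range_of_squares {e : ℕ → ℝ} (he : ∀ k, 0 ≤ e k) {q : ℝ}
    (hq : 0 < q)
    (h : Tendsto (fun j : ℕ => (((j + 1) ^ 2 : ℕ) : ℝ)⁻¹ *
      ∑ k ∈ Finset.range ((j + 1) ^ 2), e k) atTop (𝓝 q)) :
    ∀ᶠ m : ℕ in atTop, q / 8 * m ≤ ∑ k ∈ Finset.range m, e k := by
  obtain ⟨J, hJ⟩ := eventually_atTop.1 (h.eventually_const_le (half_lt_self hq))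
  filter_upwards [eventually_ge_atTop ((J + 1) ^ 2)] with m hm
  have hs : J + 1 ≤ m.sqrt := Nat.le_sqrt'.2 hm
  obtain ⟨j, hj⟩ : ∃ j, m.sqrt = j + 1 := ⟨m.sqrt - 1, by omega⟩
  have h1 : (j + 1) ^ 2 ≤ m := by simpa [hj] using Nat.sqrt_le' m
  -- This factor 4 and the `q / 2` above give the constant 8.
  have h2 : m ≤ 4 * (j + 1) ^ 2 := by
    have := Nat.lt_succ_sqrt' m
    rw [hj] at this
    simp only [Nat.succ_eq_add_one] at this
    nlinarith
  have h3 := hJ j (by omega)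
  have hpos : (0 : ℝ) < (((j + 1) ^ 2 : ℕ) : ℝ) := by positivity
  rw [inv_mul_eq_div, le_div_iff₀ hpos] at h3
  have h4 : (m : ℝ) ≤ 4 * (((j + 1) ^ 2 : ℕ) : ℝ) := by exact_mod_cast h2
  calc q / 8 * m ≤ q / 8 * (4 * (((j + 1) ^ 2 : ℕ) : ℝ)) := by gcongr
    _ = q / 2 * (((j + 1) ^ 2 : ℕ) : ℝ) := by ring
    _ ≤ _ := h3
    _ ≤ _ := Finset.sum_le_sum_of_subset_of_nonneg (Finset.range_mono h1) fun i _ _ => he i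

/-- The average of `N` terms has squared norm at most `D / N`, which is summable over the squares
`N`. -/
theorem ae_tendsto_average_along_squares {Ω : Type*} [MeasurableSpace Ω] {μ : Measure Ω}
    (w : ℕ → Lp ℝ 2 μ) {D : ℝ} (hw : ∀ m, ‖∑ k ∈ Finset.range m, w k‖ ^ 2 ≤ m * D) :
    ∀ᵐ ω ∂μ, Tendsto (fun j : ℕ => (((j + 1) ^ 2 : ℕ) : ℝ)⁻¹ *
      ∑ k ∈ Finset.range ((j + 1) ^ 2), w k ω) atTop (𝓝 0) := by
  let F : ℕ → Lp ℝ 2 μ := fun j =>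
    (((j + 1) ^ 2 : ℕ) : ℝ)⁻¹ • ∑ k ∈ Finset.range ((j + 1) ^ 2), w k
  have hsum : Summable fun j : ℕ => (((j + 1) ^ 2 : ℕ) : ℝ)⁻¹ * D := by
    have h := ((Real.summable_nat_pow_inv (p := 2)).2 (by norm_num)).comp_injective
      (add_left_injective 1)
    simpa [Function.comp_def] using h.mul_right D
  have hF : Summable fun j => ‖F j‖ ^ 2 := by
    refine hsum.of_nonneg_of_le (fun j => sq_nonneg _) fun j => ?_
    have hpos : (0 : ℝ) < (((j + 1) ^ 2 : ℕ) : ℝ) := by positivity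
    calc ‖F j‖ ^ 2 = ((((j + 1) ^ 2 : ℕ) : ℝ)⁻¹) ^ 2 *
          ‖∑ k ∈ Finset.range ((j + 1) ^ 2), w k‖ ^ 2 := by
            rw [norm_smul, mul_pow, Real.norm_eq_abs, sq_abs]
      _ ≤ ((((j + 1) ^ 2 : ℕ) : ℝ)⁻¹) ^ 2 * ((((j + 1) ^ 2 : ℕ) : ℝ) * D) := by
            gcongr
            exact hw _
      _ = _ := by field_simp
  have h1 : ∀ᵐ ω ∂μ, ∀ j, F j ω = (((j + 1) ^ 2 : ℕ) : ℝ)⁻¹ *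
      ∑ k ∈ Finset.range ((j + 1) ^ 2), w k ω := by
    refine ae_all_iff.2 fun j => ?_
    filter_upwards [Lp.coeFn_smul (((j + 1) ^ 2 : ℕ) : ℝ)⁻¹
      (∑ k ∈ Finset.range ((j + 1) ^ 2), w k),
      Lp.coeFn_finsetSum (Finset.range ((j + 1) ^ 2)) w] with ω h1 h2
    simp only [F]
    rw [h1, Pi.smul_apply, h2, Finset.sum_apply, smul_eq_mul]
  filter_upwards [ae_tendsto_zero_of_summable_norm_sq F hF, h1] with ω h h1
  simpa only [h1] using h

/-! ### Weak limits of indicators -/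

theorem norm_indicatorConstLp_one_le_one {Ω : Type*} [MeasurableSpace Ω] {μ : Measure Ω}
    [IsProbabilityMeasure μ] {s : Set Ω} (hs : MeasurableSet s) :
    ‖indicatorConstLp 2 hs (measure_ne_top μ _) (1 : ℝ)‖ ≤ 1 := by
  refine norm_indicatorConstLp_le.trans ?_
  rw [norm_one, one_mul]
  exact Real.rpow_le_one measureReal_nonneg measureReal_le_one (by positivity)

theorem exists_weak_limits_indicator {Ω : Type*} [MeasurableSpace Ω] (μ : Measure Ω)
    [IsProbabilityMeasure μ] (U : Ultrafilter ℕ) {s : ℕ → ℕ → Set Ω}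
    (hs : ∀ k n, MeasurableSet (s k n)) (hanti : ∀ n, Antitone fun k => s k n)
    {c : ℝ} (hc : ∀ k, ∀ᶠ n in U, c ≤ μ.real (s k n)) :
    ∃ (p : ℕ → Lp ℝ 2 μ) (q : Lp ℝ 2 μ), (∀ k, ‖p k‖ ≤ 1) ∧
      (∀ k y, Tendsto (fun n => inner ℝ
        (indicatorConstLp 2 (hs k n) (measure_ne_top μ _) (1 : ℝ)) y) U (𝓝 (inner ℝ (p k) y))) ∧
      (∀ k, q ≤ᵐ[μ] p k) ∧ c ≤ ∫ ω, q ω ∂μ ∧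
      (∀ A, MeasurableSet A → ∀ k,
        Tendsto (fun n => μ.real (A ∩ s k n)) U (𝓝 (∫ ω in A, p k ω ∂μ))) ∧
      (∀ A, MeasurableSet A → ∀ ε > 0, ∃ k, ∫ ω in A, p k ω ∂μ < ∫ ω in A, q ω ∂μ + ε) := by
  have hint : ∀ g : Lp ℝ 2 μ, Integrable g μ := fun g =>
    (Lp.memLp g).integrable (by norm_num)
  have hin : ∀ (A : Set Ω) (hA : MeasurableSet A) (g : Lp ℝ 2 μ),
      inner ℝ g (indicatorConstLp 2 hA (measure_ne_top μ A) (1 : ℝ)) = ∫ ω in A, g ω ∂μ :=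
    fun A hA g => by
      rw [real_inner_comm, L2.inner_indicatorConstLp_one]
  choose p hp1 hp using fun k => exists_weak_limit_ultrafilter U
    (fun n => indicatorConstLp 2 (hs k n) (measure_ne_top μ _) (1 : ℝ))
    (fun n => norm_indicatorConstLp_one_le_one (hs k n))
  obtain ⟨q, -, hq⟩ := exists_weak_limit_ultrafilter (hyperfilter ℕ) p hp1
  have hV : ((hyperfilter ℕ : Ultrafilter ℕ) : Filter ℕ) ≤ atTop := Nat.hyperfilter_le_atTop
  have hA : ∀ A, MeasurableSet A → ∀ k,
      Tendsto (fun n => μ.real (A ∩ s k n)) U (𝓝 (∫ ω in A, p k ω ∂μ)) := fun A hA k => by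
    have h := hp k (indicatorConstLp 2 hA (measure_ne_top μ A) (1 : ℝ))
    rw [hin] at h
    refine h.congr fun n => ?_
    rw [hin, setIntegral_congr_ae hA (indicatorConstLp_coeFn.mono fun ω h _ => h),
      integral_indicator_const _ (hs k n), measureReal_restrict_apply (hs k n), smul_eq_mul,
      mul_one, Set.inter_comm]
  have hAq : ∀ A, MeasurableSet A →
      Tendsto (fun k => ∫ ω in A, p k ω ∂μ) (hyperfilter ℕ) (𝓝 (∫ ω in A, q ω ∂μ)) :=
    fun A hA => by
      have h := hq (indicatorConstLp 2 hA (measure_ne_top μ A) (1 : ℝ))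
      simpa only [hin] using h
  -- Monotonicity in the level passes to the limit set by set, which yields `q ≤ p k` a.e.
  have hmono : ∀ A, MeasurableSet A → Antitone fun k => ∫ ω in A, p k ω ∂μ :=
    fun A hAm k l hkl => le_of_tendsto_of_tendsto' (hA A hAm l) (hA A hAm k) fun n =>
      measureReal_mono (Set.inter_subset_inter_right A (hanti n hkl))
  refine ⟨p, q, hp1, hp, fun k => ?_, ?_, hA, fun A hAm ε hε => ?_⟩
  · refine ae_le_of_forall_setIntegral_le (hint q) (hint (p k)) fun A hAm _ => ?_
    exact le_of_tendsto (hAq A hAm)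
      (((eventually_ge_atTop k).filter_mono hV).mono fun l hl => hmono A hAm hl)
  · have h := hAq Set.univ MeasurableSet.univ
    rw [setIntegral_univ] at h
    refine ge_of_tendsto' h fun k => ge_of_tendsto (hA _ MeasurableSet.univ k) ?_
    filter_upwards [hc k] with n hn
    rwa [Set.univ_inter]
  · exact ((hAq A hAm).eventually_lt_const (lt_add_of_pos_right _ hε)).exists

/-! ### Almost orthogonal subsequences -/

theorem sum_abs_inner_le {H : Type*} [NormedAddCommGroup H] [InnerProductSpace ℝ H]
    (v : ℕ → H) {M : ℝ} (hM : ∀ j, ‖v j‖ ≤ M) (k : ℕ)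
    (hv : ∀ i j, k ≤ i → i < j → |inner ℝ (v i) (v j)| ≤ (1 / 2) ^ i) (j : ℕ) :
    ∑ i ∈ Finset.range j, |inner ℝ (v i) (v j)| ≤ k * M ^ 2 + 2 := by
  have hterm : ∀ i ∈ Finset.range j,
      |inner ℝ (v i) (v j)| ≤ (if i < k then M ^ 2 else 0) + (1 / 2) ^ i := fun i hi => by
    split_ifs with h
    · have h1 := abs_real_inner_le_norm (v i) (v j)
      have h2 := mul_le_mul (hM i) (hM j) (norm_nonneg _) ((norm_nonneg _).trans (hM i))
      have h3 : (0 : ℝ) ≤ (1 / 2) ^ i := by positivity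
      nlinarith
    · simpa using hv i j (not_lt.1 h) (Finset.mem_range.1 hi)
  refine (Finset.sum_le_sum hterm).trans ?_
  rw [Finset.sum_add_distrib]
  refine add_le_add ?_ (sum_geometric_two_le j)
  rw [← Finset.sum_filter, Finset.sum_const, nsmul_eq_mul]
  refine mul_le_mul_of_nonneg_right ?_ (sq_nonneg M)
  have : (Finset.range j).filter (· < k) ⊆ Finset.range k := fun i hi => by
    simpa using (Finset.mem_filter.1 hi).2
  exact_mod_cast (Finset.card_le_card this).trans_eq (Finset.card_range k)

/-- Given weak limits `p k` of `e k n`, there is a subsequence along which the centered vectors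
`e k n - p k` are almost orthogonal and the convergent real sequences `a k` are almost bounded by
their limits. -/
theorem exists_almost_orthogonal_subsequence {Ω : Type*} [MeasurableSpace Ω] (μ : Measure Ω)
    [IsProbabilityMeasure μ] (U : Ultrafilter ℕ) (hU : (U : Filter ℕ) ≤ atTop)
    {e : ℕ → ℕ → Lp ℝ 2 μ} {p : ℕ → Lp ℝ 2 μ}
    (hp : ∀ k y, Tendsto (fun n => inner ℝ (e k n) y) U (𝓝 (inner ℝ (p k) y)))
    {a : ℕ → ℕ → ℝ} {b : ℕ → ℝ} (ha : ∀ k, Tendsto (a k) U (𝓝 (b k))) :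
    ∃ φ : ℕ → ℕ, StrictMono φ ∧ ∀ i j k, k ≤ i → i < j →
      |inner ℝ (e k (φ i) - p k) (e k (φ j) - p k)| ≤ (1 / 2) ^ i ∧
      a k (φ j) ≤ b k + (1 / 2) ^ i := by
  have hev : ∀ x : ℕ, ∀ᶠ y in U, x < y ∧ ∀ k ∈ Finset.range (x + 1),
      |inner ℝ (e k x - p k) (e k y - p k)| ≤ (1 / 2) ^ x ∧ a k y ≤ b k + (1 / 2) ^ x := by
    intro x
    have hx : (0 : ℝ) < (1 / 2) ^ x := by positivity
    refine ((eventually_gt_atTop x).filter_mono hU).and ((Finset.eventually_all _).2 fun k _ => ?_)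
    have h1 : Tendsto (fun y => |inner ℝ (e k x - p k) (e k y - p k)|) U (𝓝 0) := by
      have h := (hp k (e k x - p k)).sub_const (inner ℝ (p k) (e k x - p k))
      rw [sub_self] at h
      have h' := h.abs
      rw [abs_zero] at h'
      refine h'.congr fun y => ?_
      rw [← inner_sub_left, real_inner_comm]
    exact (h1.eventually_le_const hx).and
      ((ha k).eventually_le_const (lt_add_of_pos_right _ hx))
  -- Only levels `k ≤ x` are constrained, so each choice meets finitely many conditions.
  obtain ⟨φ, -, hφ⟩ := exists_seq_of_forall_finset_exists (fun _ : ℕ => True)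
    (fun x y => x < y ∧ ∀ k ∈ Finset.range (x + 1),
      |inner ℝ (e k x - p k) (e k y - p k)| ≤ (1 / 2) ^ x ∧ a k y ≤ b k + (1 / 2) ^ x)
    (fun t _ => by
      obtain ⟨y, hy⟩ := ((Finset.eventually_all t).2 fun x _ => hev x).exists
      exact ⟨y, trivial, hy⟩)
  have hmono : StrictMono φ := fun m n h => (hφ m n h).1
  refine ⟨φ, hmono, fun i j k hki hij => ?_⟩
  have hi : i ≤ φ i := hmono.le_apply
  have hpow : (1 / 2 : ℝ) ^ φ i ≤ (1 / 2) ^ i :=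
    pow_le_pow_of_le_one (by norm_num) (by norm_num) hi
  obtain ⟨h1, h2⟩ := (hφ i j hij).2 k (Finset.mem_range.2 (by omega))
  exact ⟨h1.trans hpow, h2.trans (by linarith)⟩

theorem ae_tendsto_average_rearranged_subsequence {Ω : Type*} [MeasurableSpace Ω]
    {μ : Measure Ω} (v : ℕ → Lp ℝ 2 μ) {M : ℝ} (hM : ∀ j, ‖v j‖ ≤ M) (k : ℕ)
    (hv : ∀ i j, k ≤ i → i < j → |inner ℝ (v i) (v j)| ≤ (1 / 2) ^ i)
    {σ : ℕ → ℕ} (hσ : Function.Injective σ) :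
    ∀ᵐ ω ∂μ, Tendsto (fun j : ℕ => (((j + 1) ^ 2 : ℕ) : ℝ)⁻¹ *
      ∑ i ∈ Finset.range ((j + 1) ^ 2), v (σ i) ω) atTop (𝓝 0) := by
  refine ae_tendsto_average_along_squares (fun i => v (σ i))
    (D := M ^ 2 + 2 * (k * M ^ 2 + 2)) fun m => ?_
  have h := norm_sum_sq_le_of_almost_orthogonal v hM (sum_abs_inner_le v hM k hv)
    ((Finset.range m).image σ)
  rwa [Finset.sum_image fun _ _ _ _ h => hσ h, Finset.card_image_of_injective _ hσ,
    Finset.card_range] at h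

theorem ae_eventually_le_sum_indicator {Ω : Type*} [MeasurableSpace Ω]
    {μ : Measure Ω} [IsProbabilityMeasure μ] {t : ℕ → Set Ω} (ht : ∀ n, MeasurableSet (t n))
    (p : Lp ℝ 2 μ)
    (h : ∀ᵐ ω ∂μ, Tendsto (fun j : ℕ => (((j + 1) ^ 2 : ℕ) : ℝ)⁻¹ *
      ∑ i ∈ Finset.range ((j + 1) ^ 2),
        (indicatorConstLp 2 (ht i) (measure_ne_top μ _) (1 : ℝ) - p : Lp ℝ 2 μ) ω)
          atTop (𝓝 0)) :
    ∀ᵐ ω ∂μ, 0 < p ω → ∀ᶠ m : ℕ in atTop,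
      p ω / 8 * m ≤ ∑ i ∈ Finset.range m, (t i).indicator (fun _ => (1 : ℝ)) ω := by
  have hv : ∀ᵐ ω ∂μ, ∀ i,
      (indicatorConstLp 2 (ht i) (measure_ne_top μ _) (1 : ℝ) - p : Lp ℝ 2 μ) ω =
        (t i).indicator (fun _ => (1 : ℝ)) ω - p ω := by
    refine ae_all_iff.2 fun i => ?_
    filter_upwards [Lp.coeFn_sub (indicatorConstLp 2 (ht i) (measure_ne_top μ _) (1 : ℝ)) p,
      indicatorConstLp_coeFn (p := 2) (hs := ht i) (hμs := measure_ne_top μ _) (c := (1 : ℝ))]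
      with ω h1 h2
    rw [h1, Pi.sub_apply, h2]
  filter_upwards [h, hv] with ω h hv hpos
  refine eventually_mul_le_sum_range_of_squares
    (fun i => Set.indicator_nonneg (fun _ _ => zero_le_one) ω) hpos ?_
  have h' := h.add_const (p ω)
  rw [zero_add] at h'
  refine h'.congr fun j => ?_
  have hne : (((j + 1) ^ 2 : ℕ) : ℝ) ≠ 0 := by positivity
  simp only [hv]
  rw [Finset.sum_sub_distrib, Finset.sum_const, Finset.card_range, nsmul_eq_mul, mul_sub,
    inv_mul_cancel_left₀ hne, sub_add_cancel]

/-! ### Divergence on `C` and conclusion -/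

theorem tendsto_cesaroMean_atTop {Ω : Type*} {h : ℕ → Ω → ℝ} (hh : ∀ n ω, 0 ≤ h n ω) {ω : Ω}
    {q : ℝ} (hq : 0 < q)
    (H : ∀ k : ℕ, ∀ᶠ m : ℕ in atTop, q * m ≤
      ∑ i ∈ Finset.range m, {ω | (k : ℝ) ≤ h i ω}.indicator (fun _ => (1 : ℝ)) ω) :
    Tendsto (fun m : ℕ => cesaroMean h m ω) atTop atTop := by
  refine tendsto_atTop.2 fun B => ?_
  obtain ⟨k, hk⟩ := exists_nat_ge (B / q)
  rw [div_le_iff₀ hq] at hk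
  filter_upwards [H k, eventually_gt_atTop 0] with m hm hm0
  have hmpos : (0 : ℝ) < m := Nat.cast_pos.2 hm0
  have h1 : (k : ℝ) * ∑ i ∈ Finset.range m,
      {ω | (k : ℝ) ≤ h i ω}.indicator (fun _ => (1 : ℝ)) ω ≤ ∑ i ∈ Finset.range m, h i ω := by
    rw [Finset.mul_sum]
    refine Finset.sum_le_sum fun i _ => ?_
    by_cases hi : (k : ℝ) ≤ h i ω
    · simp [Set.indicator, hi]
    · simpa [Set.indicator, hi] using hh i ω
  rw [cesaroMean, one_div, inv_mul_eq_div, le_div_iff₀ hmpos]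
  calc B * m ≤ k * q * m := by gcongr
    _ = k * (q * m) := by ring
    _ ≤ _ := by gcongr
    _ ≤ _ := h1

theorem exists_ultrafilter_eventually_le_measure {Ω : Type*} [MeasurableSpace Ω] (μ : Measure Ω)
    [IsProbabilityMeasure μ] {f : ℕ → Ω → ℝ} (hf : ∀ n, Measurable (f n)) {b : ℝ≥0∞}
    (hb : Tendsto (supTail μ f) atTop (𝓝 b)) (hb_pos : 0 < b) :
    ∃ (U : Ultrafilter ℕ) (c : ℝ), (U : Filter ℕ) ≤ atTop ∧ 0 < c ∧
      ∀ k : ℕ, ∀ᶠ n in U, c ≤ μ.real {ω | (k : ℝ) ≤ f n ω} := by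
  obtain ⟨c, hc0, hcb⟩ := exists_between hb_pos
  have hc_top : c ≠ ⊤ := (hcb.trans_le le_top).ne
  choose n hn hcn using exists_ge_lt_measure_of_lt_supTail μ hf hc0 fun k =>
    hcb.trans_le ((supTail_antitone μ f).le_of_tendsto hb k)
  have hV : ((hyperfilter ℕ : Ultrafilter ℕ) : Filter ℕ) ≤ atTop := Nat.hyperfilter_le_atTop
  -- The index `n j`, chosen for level `j`, serves every level `k ≤ j`.
  refine ⟨(hyperfilter ℕ).map n, c.toReal, ?_, ENNReal.toReal_pos hc0.ne' hc_top, fun k => ?_⟩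
  · exact (tendsto_atTop_mono hn tendsto_id).mono_left hV
  · have h : ∀ᶠ j in (hyperfilter ℕ : Filter ℕ), c.toReal ≤ μ.real {ω | (k : ℝ) ≤ f (n j) ω} := by
      filter_upwards [(eventually_ge_atTop k).filter_mono hV] with j hj
      exact ENNReal.toReal_mono (measure_ne_top _ _) ((hcn j).le.trans
        (measure_mono (setOf_natCast_le_antitone _ hj)))
    exact h

theorem mainTheorem2 {Ω : Type*} [MeasurableSpace Ω] (μ : Measure Ω) [IsProbabilityMeasure μ]
    (f : ℕ → Ω → ℝ) (hf_meas : ∀ n, Measurable (f n)) (hf_nonneg : ∀ n ω, 0 ≤ f n ω)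
    (b : ℝ≥0∞) (hb : Tendsto (fun k : ℕ => supTail μ f k) atTop (𝓝 b)) (hb_pos : 0 < b) :
    ∃ (C : Set Ω) (g : ℕ → Ω → ℝ),
      MeasurableSet C ∧ 0 < μ C ∧
      (∃ φ : ℕ → ℕ, StrictMono φ ∧ ∀ n, g n = f (φ n)) ∧
      (∀ ψ : ℕ → ℕ, StrictMono ψ → ∀ π : Equiv.Perm ℕ,
        ∀ᵐ ω ∂μ, ω ∈ C →
          Tendsto (fun m : ℕ => cesaroMean (fun k => g (ψ (π k))) m ω) atTop atTop) ∧
      Tendsto (fun k : ℕ => supTail μ (fun n => Cᶜ.indicator (g n)) k) atTop (𝓝 0) := by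
  obtain ⟨U, c, hU, hc0, hc⟩ := exists_ultrafilter_eventually_le_measure μ hf_meas hb hb_pos
  have hs : ∀ k n : ℕ, MeasurableSet {ω | (k : ℝ) ≤ f n ω} := fun k n =>
    measurableSet_le measurable_const (hf_meas n)
  obtain ⟨p, q, hp1, hp, hqp, hcq, hA, hAq⟩ := exists_weak_limits_indicator μ U hs
    (fun n => setOf_natCast_le_antitone (f n)) hc
  let C : Set Ω := {ω | 0 < q ω}
  have hC : MeasurableSet C :=
    measurableSet_lt measurable_const (Lp.stronglyMeasurable q).measurable
  -- The real sequences controlled here are the tails restricted to `Cᶜ`.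
  obtain ⟨φ, hφ, horth⟩ := exists_almost_orthogonal_subsequence μ U hU hp (hA Cᶜ hC.compl)
  refine ⟨C, fun n => f (φ n), hC, ?_, ⟨φ, hφ, fun _ => rfl⟩, fun ψ hψ π => ?_, ?_⟩
  · rw [pos_iff_ne_zero]
    intro h0
    have h1 : ∀ᵐ ω ∂μ, q ω ≤ 0 := (measure_eq_zero_iff_ae_notMem.1 h0).mono
      fun ω h => not_lt.1 h
    exact (hc0.trans_le hcq).not_ge (integral_nonpos_of_ae h1)
  · have hk : ∀ᵐ ω ∂μ, ∀ k : ℕ, 0 < p k ω → ∀ᶠ m : ℕ in atTop, p k ω / 8 * m ≤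
        ∑ i ∈ Finset.range m,
          {ω | (k : ℝ) ≤ f (φ (ψ (π i))) ω}.indicator (fun _ => (1 : ℝ)) ω := by
      refine ae_all_iff.2 fun k => ?_
      refine ae_eventually_le_sum_indicator (fun i => hs k (φ (ψ (π i)))) (p k) ?_
      refine ae_tendsto_average_rearranged_subsequence (M := 2)
        (fun n => indicatorConstLp 2 (hs k (φ n)) (measure_ne_top μ _) (1 : ℝ) - p k)
        (fun n => ?_) k (fun i j hki hij => (horth i j k hki hij).1)
        (hψ.injective.comp π.injective)
      refine (norm_sub_le _ _).trans ?_
      linarith [hp1 k, norm_indicatorConstLp_one_le_one (μ := μ) (hs k (φ n))]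
    filter_upwards [hk, ae_all_iff.2 hqp] with ω hk hqp hω
    refine tendsto_cesaroMean_atTop (fun n ω => hf_nonneg _ ω) (q := q ω / 8)
      (by have : 0 < q ω := hω; positivity) fun k => ?_
    filter_upwards [hk k (lt_of_lt_of_le hω (hqp k))] with m hm
    refine le_trans ?_ hm
    gcongr
    exact hqp k
  · refine tendsto_supTail_zero μ (fun n => (hf_meas _).indicator hC.compl) fun ε hε => ?_
    obtain ⟨δ, hδ0, hδε⟩ := ENNReal.lt_iff_exists_real_btwn.1 hε
    have hδ : 0 < δ := by simpa using hδε.1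
    have hq0 : ∫ ω in Cᶜ, q ω ∂μ ≤ 0 :=
      setIntegral_nonpos hC.compl fun ω hω => not_lt.1 hω
    obtain ⟨k, hk⟩ := hAq Cᶜ hC.compl (δ / 2) (half_pos hδ)
    obtain ⟨i, hi⟩ := exists_pow_lt_of_lt_one (half_pos hδ) (by norm_num : (1 / 2 : ℝ) < 1)
    have hpow : (1 / 2 : ℝ) ^ max i k ≤ (1 / 2) ^ i :=
      pow_le_pow_of_le_one (by norm_num) (by norm_num) (le_max_left _ _)
    -- The level `k + 1` is positive even if `k = 0`, so the indicator cannot reach it on `C`.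
    refine ⟨k + 1, max i k + 1, fun n hn => ?_⟩
    have h1 := (horth (max i k) n k (le_max_right _ _) hn).2
    have h2 : {ω | ((k + 1 : ℕ) : ℝ) ≤ Cᶜ.indicator (f (φ n)) ω} ⊆
        Cᶜ ∩ {ω | (k : ℝ) ≤ f (φ n) ω} := fun ω hω => by
      have hω' : (k : ℝ) + 1 ≤ Cᶜ.indicator (f (φ n)) ω := by simpa using hω
      have hk0 : (0 : ℝ) ≤ k := k.cast_nonneg
      by_cases h : ω ∈ Cᶜ
      · rw [Set.indicator_of_mem h] at hω'
        exact ⟨h, show (k : ℝ) ≤ f (φ n) ω by linarith⟩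
      · rw [Set.indicator_of_notMem h] at hω'
        linarith
    refine (measure_mono h2).trans (le_trans ?_ hδε.2.le)
    rw [← ofReal_measureReal]
    exact ENNReal.ofReal_le_ofReal (by linarith)
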